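/- All rings are associative and unital, not necessarily commutative, and ring homomorphisms preserve $1$. A pair $(A,I)$ is a ring $A$ with a two-sided ideal $I$; a morphism of pairs $(A,I)\to(B,J)$ is a ring homomorphism $\varphi:A\to B$ with $\varphi^{-1}(J)=I$. A local pair is a pair $(A,I)$ in which the nonunits of $A$ form an ideal (i.e. $A$ is a local ring) and $I$ is this ideal, the maximal ideal of $A$. Put $I^{(1)}=I$ and let $I^{(n+1)}$ be the two-sided ideal of $A$ generated by all $st-ts$ with $s\in A$, $t\in I^{(n)}$; the pair $(A,I)$ is perfect if $\bigcap_{n\ge 1}I^{(n)}=0$. Polynomials are taken in an indeterminate $x$ that commutes with the coefficients, and $F\mapsto\bar F$ denotes reduction $A[x]\to(A/I)[x]$. A pair $(A,I)$ is left Henselian if $I$ is contained in the Jacobson radical of $A$ and, for every monic $F\in A[x]$ and all monic $f_1,f_2\in(A/I)[x]$ with $\bar F=f_1f_2$ and $(A/I)[x]f_1+(A/I)[x]f_2=(A/I)[x]$, there is a unique pair of monic polynomials $F_1,F_2\in A[x]$ with $F=F_1F_2$, $\bar F_1=f_1$ and $\bar F_2=f_2$. Right Henselian is defined in the same way, with $f_1(A/I)[x]+f_2(A/I)[x]=(A/I)[x]$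 as the coprimality condition. A left (resp. right) Henselization of $(A,I)$ is a perfect left (resp. right) Henselian pair $(H,K)$ together with a morphism of pairs $\eta:(A,I)\to(H,K)$ such that for every morphism of pairs $\varphi:(A,I)\to(B,J)$ to a perfect left (resp. right) Henselian pair there is a unique morphism of pairs $\psi:(H,K)\to(B,J)$ with $\varphi=\psi\circ\eta$. **Proposition.** Let $(A,I)$ be a perfect local pair. Then $(A,I)$ has a left Henselization, and every left Henselization $(H,K)$ of $(A,I)$ is a local pair. Likewise, $(A,I)$ has a right Henselization, and every right Henselization of $(A,I)$ is a local pair. -/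

import Mathlib

open Polynomial

universe u

/-! Pairs `(A, I)`: a (not necessarily commutative) unital ring `A` with a two-sided ideal `I`. -/

namespace RingPair

variable {A B : Type*} [Ring A] [Ring B]

/-- The quotient homomorphism `A → A / I`. -/
abbrev residue (I : TwoSidedIdeal A) : A →+* I.ringCon.Quotient := I.ringCon.mk'

/-- The reduction of a polynomial `F ∈ A[x]` to `(A / I)[x]`. -/
noncomputable abbrev reduction (I : TwoSidedIdeal A) (F : A[X]) : I.ringCon.Quotient[X] :=
  F.map (residue I)

/-- A ring homomorphism `φ : A → B` is a morphism of pairs `(A, I) → (B, J)` if `φ⁻¹(J) = I`. -/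
def IsHom (I : TwoSidedIdeal A) (J : TwoSidedIdeal B) (φ : A →+* B) : Prop :=
  ∀ a : A, φ a ∈ J ↔ a ∈ I

/-- `A[x] F₁ + A[x] F₂ = A[x]`. -/
def LeftCoprime (F₁ F₂ : A[X]) : Prop := ∃ G₁ G₂ : A[X], G₁ * F₁ + G₂ * F₂ = 1

/-- `F₁ A[x] + F₂ A[x] = A[x]`. -/
def RightCoprime (F₁ F₂ : A[X]) : Prop := ∃ G₁ G₂ : A[X], F₁ * G₁ + F₂ * G₂ = 1

/-- `(A, I)` is a Jacobson pair if `I` is contained in the Jacobson radical of `A`. -/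
def IsJacobson (I : TwoSidedIdeal A) : Prop := ∀ a ∈ I, a ∈ Ring.jacobson A

/-- The commutator filtration, indexed from `0`: `commFiltration I n` is `I⁽ⁿ⁺¹⁾`, where
`I⁽¹⁾ = I` and `I⁽ⁿ⁺¹⁾` is the two-sided ideal generated by all `s t - t s`, `s ∈ A`,
`t ∈ I⁽ⁿ⁾`. -/
def commFiltration (I : TwoSidedIdeal A) : ℕ → TwoSidedIdeal A
  | 0 => I
  | n + 1 => TwoSidedIdeal.span {c | ∃ s t : A, t ∈ commFiltration I n ∧ c = s * t - t * s}

/-- `(A, I)` is perfect if its commutator filtration has zero intersection. -/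
def IsPerfect (I : TwoSidedIdeal A) : Prop := ⨅ n, commFiltration I n = ⊥

/-- Left Henselian pairs: Jacobson pairs in which every factorization `F̄ = f₁ f₂` of the reduction
of a monic `F` into left coprime monic polynomials lifts uniquely to a factorization `F = F₁ F₂`
into monic polynomials. -/
def IsLeftHenselian (I : TwoSidedIdeal A) : Prop :=
  IsJacobson I ∧
    ∀ F : A[X], F.Monic → ∀ f₁ f₂ : I.ringCon.Quotient[X], f₁.Monic → f₂.Monic →
      LeftCoprime f₁ f₂ → reduction I F = f₁ * f₂ →
        ∃! P : A[X] × A[X], P.1.Monic ∧ P.2.Monic ∧ F = P.1 * P.2 ∧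
          reduction I P.1 = f₁ ∧ reduction I P.2 = f₂

/-- Right Henselian pairs: the same with right coprime polynomials. -/
def IsRightHenselian (I : TwoSidedIdeal A) : Prop :=
  IsJacobson I ∧
    ∀ F : A[X], F.Monic → ∀ f₁ f₂ : I.ringCon.Quotient[X], f₁.Monic → f₂.Monic →
      RightCoprime f₁ f₂ → reduction I F = f₁ * f₂ →
        ∃! P : A[X] × A[X], P.1.Monic ∧ P.2.Monic ∧ F = P.1 * P.2 ∧
          reduction I P.1 = f₁ ∧ reduction I P.2 = f₂

/-- `η : (A, I) → (H, K)` is a left Henselization: a morphism to a perfect left Henselian pair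
through which every morphism to a perfect left Henselian pair factors uniquely. -/
structure IsLeftHenselization {A H : Type u} [Ring A] [Ring H] (I : TwoSidedIdeal A)
    (K : TwoSidedIdeal H) (η : A →+* H) : Prop where
  isHom : IsHom I K η
  isPerfect : IsPerfect K
  isLeftHenselian : IsLeftHenselian K
  universal : ∀ (B : Type u) [Ring B] (J : TwoSidedIdeal B), IsPerfect J → IsLeftHenselian J →
    ∀ φ : A →+* B, IsHom I J φ → ∃! ψ : H →+* B, IsHom K J ψ ∧ ψ.comp η = φ

/-- `η : (A, I) → (H, K)` is a right Henselization: a morphism to a perfect right Henselian pair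
through which every morphism to a perfect right Henselian pair factors uniquely. -/
structure IsRightHenselization {A H : Type u} [Ring A] [Ring H] (I : TwoSidedIdeal A)
    (K : TwoSidedIdeal H) (η : A →+* H) : Prop where
  isHom : IsHom I K η
  isPerfect : IsPerfect K
  isRightHenselian : IsRightHenselian K
  universal : ∀ (B : Type u) [Ring B] (J : TwoSidedIdeal B), IsPerfect J → IsRightHenselian J →
    ∀ φ : A →+* B, IsHom I J φ → ∃! ψ : H →+* B, IsHom K J ψ ∧ ψ.comp η = φ

/-- `(A, I)` is a local pair: the nonunits of `A` form an ideal (that is, `A` is a local ring),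
and `I` is this ideal, which is then the unique maximal ideal of `A`. -/
def IsLocalPair (I : TwoSidedIdeal A) : Prop := (I : Set A) = nonunits A

/-- The ring of a local pair is local in the sense of Mathlib. -/
theorem IsLocalPair.isLocalRing {I : TwoSidedIdeal A} (h : IsLocalPair I) : IsLocalRing A := by
  have hm : ∀ a : A, a ∈ I ↔ ¬ IsUnit a := fun a => by
    rw [← SetLike.mem_coe, h]; rfl
  have h1 : (1 : A) ∉ I := fun h' => (hm 1).1 h' isUnit_one
  have : Nontrivial A := ⟨⟨1, 0, fun h' => h1 (h' ▸ I.zero_mem)⟩⟩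
  refine ⟨fun {a b} hab => ?_⟩
  by_contra hc
  rw [not_or] at hc
  exact h1 (hab ▸ I.add_mem ((hm a).2 hc.1) ((hm b).2 hc.2))

end RingPair

/-!
The Henselization of `(A, I)` is found inside the product of all perfect Henselian pairs under
`(A, I)`, which is again perfect and Henselian: it is the smallest subring which contains `A` and is
stable under inverting `1 + b` for `b` in the ideal and under lifting factorizations. Inverses and
lifted factors reduce into `A / I`, so this subring has residue ring `A / I`. Hence the
factorizations to be lifted over it come from `A / I`, and it is Henselian. Two morphisms which
agree on `A` agree on it, because inverses and lifted factors are unique, and the projections of the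
product provide the morphism to any given pair.

The product is too large for the universe of `A`, but the subring is not: each of its elements is
named by a well-founded tree of operations. Since any Henselization has residue ring `A / I` and its
ideal is contained in the Jacobson radical, it is local exactly when `A / I` is a division ring.
-/

namespace RingPair

section Residue

variable {A B C : Type*} [Ring A] [Ring B] [Ring C]

theorem residue_eq_zero_iff (I : TwoSidedIdeal A) {a : A} : residue I a = 0 ↔ a ∈ I := by
  rw [← TwoSidedIdeal.mem_ker, TwoSidedIdeal.ker_ringCon_mk']

theorem residue_eq_residue_iff (I : TwoSidedIdeal A) {a b : A} :
    residue I a = residue I b ↔ a - b ∈ I := by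
  rw [← sub_eq_zero, ← map_sub, residue_eq_zero_iff]

theorem residue_surjective (I : TwoSidedIdeal A) : Function.Surjective (residue I) :=
  I.ringCon.mk'_surjective

theorem residue_bot_bijective : Function.Bijective (residue (⊥ : TwoSidedIdeal A)) :=
  ⟨TwoSidedIdeal.ker_eq_bot _ |>.1 (TwoSidedIdeal.ker_ringCon_mk' ⊥), residue_surjective _⟩

variable {I : TwoSidedIdeal A} {J : TwoSidedIdeal B} {K : TwoSidedIdeal C} {φ : A →+* B}

theorem isHom_residue (I : TwoSidedIdeal A) : IsHom I ⊥ (residue I) := fun a => by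
  rw [TwoSidedIdeal.mem_bot, residue_eq_zero_iff]

theorem IsHom.comp {ψ : B →+* C} (hψ : IsHom J K ψ) (hφ : IsHom I J φ) : IsHom I K (ψ.comp φ) :=
  fun a => (hψ _).trans (hφ a)

theorem IsHom.le_comap (hφ : IsHom I J φ) : I ≤ J.comap φ :=
  fun a ha => (TwoSidedIdeal.mem_comap φ).2 ((hφ a).2 ha)

theorem isHom_comap (J : TwoSidedIdeal B) (φ : A →+* B) : IsHom (J.comap φ) J φ :=
  fun _ => (TwoSidedIdeal.mem_comap φ).symm

/-- The homomorphism of residue rings induced by a ring homomorphism which maps `I` into `J`. -/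
def residueMap (h : I ≤ J.comap φ) : I.ringCon.Quotient →+* J.ringCon.Quotient :=
  I.ringCon.lift ((residue J).comp φ) fun a b hab => by
    rw [TwoSidedIdeal.rel_iff] at hab
    refine (residue_eq_residue_iff J).2 ?_
    rw [← map_sub]
    exact (TwoSidedIdeal.mem_comap φ).1 (h hab)

theorem residueMap_residue (h : I ≤ J.comap φ) (a : A) :
    residueMap h (residue I a) = residue J (φ a) := rfl

theorem IsHom.residueMap_injective (hφ : IsHom I J φ) :
    Function.Injective (residueMap hφ.le_comap) := by
  rw [injective_iff_map_eq_zero]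
  intro q hq
  obtain ⟨a, rfl⟩ := residue_surjective I q
  rw [residueMap_residue, residue_eq_zero_iff] at hq
  exact (residue_eq_zero_iff I).2 ((hφ a).1 hq)

theorem reduction_map (h : I ≤ J.comap φ) (F : A[X]) :
    reduction J (F.map φ) = (reduction I F).map (residueMap h) := by
  rw [reduction, reduction, Polynomial.map_map, Polynomial.map_map]
  rfl

theorem reduction_map_map {η : C →+* A} (h : I ≤ J.comap φ) (F : C[X]) :
    (reduction I (F.map η)).map (residueMap h) = reduction J (F.map (φ.comp η)) := by
  rw [← reduction_map, Polynomial.map_map]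

theorem isHom_of_isHom_comp {η : A →+* B} {ψ : B →+* C} (hη : I ≤ J.comap η)
    (hsurj : Function.Surjective ((residue J).comp η)) (hψ : J ≤ K.comap ψ)
    (hcomp : IsHom I K (ψ.comp η)) : IsHom J K ψ := by
  refine fun b => ⟨fun hb => ?_, fun hb => (TwoSidedIdeal.mem_comap ψ).1 (hψ hb)⟩
  obtain ⟨a, ha : residue J (η a) = residue J b⟩ := hsurj (residue J b)
  have hψa : ψ (η a) ∈ K := by
    rwa [← residue_eq_zero_iff, ← residueMap_residue hψ, ha, residueMap_residue,
      residue_eq_zero_iff]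
  rw [← residue_eq_zero_iff, ← ha]
  exact (residue_eq_zero_iff J).2 ((TwoSidedIdeal.mem_comap η).1 (hη ((hcomp a).1 hψa)))

end Residue

section Jacobson

variable {A : Type*} [Ring A] {I : TwoSidedIdeal A}

theorem isJacobson_iff_exists_mul_one_add : IsJacobson I ↔ ∀ a ∈ I, ∃ c, c * (1 + a) = 1 := by
  refine ⟨fun hI a ha => ?_, fun h a ha => ?_⟩
  · have hmem : 1 + a - 1 ∈ Ideal.jacobson (⊥ : Ideal A) := by
      rw [add_sub_cancel_left, Ideal.jacobson_bot]
      exact hI a ha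
    obtain ⟨c, hc⟩ := Ideal.exists_mul_sub_mem_of_sub_one_mem_jacobson _ hmem
    exact ⟨c, sub_eq_zero.1 hc⟩
  · rw [← Ideal.jacobson_bot, Ideal.mem_jacobson_iff]
    intro b
    obtain ⟨c, hc⟩ := h (b * a) (I.mul_mem_left b a ha)
    exact ⟨c, by rw [Ideal.mem_bot, sub_eq_zero, mul_assoc, add_comm, ← mul_one_add, hc]⟩

theorem IsJacobson.exists_mul_eq_one (hI : IsJacobson I) {a : A} (ha : residue I a = 1) :
    ∃ c, c * a = 1 := by
  rw [← map_one (residue I), residue_eq_residue_iff] at ha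
  obtain ⟨c, hc⟩ := isJacobson_iff_exists_mul_one_add.1 hI _ ha
  exact ⟨c, by rwa [add_sub_cancel] at hc⟩

theorem IsJacobson.isUnit_of_residue_eq_one (hI : IsJacobson I) {a : A} (ha : residue I a = 1) :
    IsUnit a := by
  obtain ⟨b, hba⟩ := hI.exists_mul_eq_one ha
  have hb : residue I b = 1 := by
    rw [← map_one (residue I), ← hba, map_mul, ha, mul_one]
  obtain ⟨c, hcb⟩ := hI.exists_mul_eq_one hb
  have hca : c = a := left_inv_eq_right_inv hcb hba
  exact ⟨⟨a, b, hca ▸ hcb, hba⟩, rfl⟩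

theorem isJacobson_iff_isLocalHom : IsJacobson I ↔ IsLocalHom (residue I) := by
  refine ⟨fun hI => ⟨fun a ha => ?_⟩,
    fun h => isJacobson_iff_exists_mul_one_add.2 fun a ha => ?_⟩
  · obtain ⟨q, hq⟩ := ha.exists_left_inv
    obtain ⟨q', hq'⟩ := ha.exists_right_inv
    obtain ⟨b, rfl⟩ := residue_surjective I q
    obtain ⟨c, rfl⟩ := residue_surjective I q'
    rw [← map_mul] at hq hq'
    obtain ⟨b', hb'⟩ := (hI.isUnit_of_residue_eq_one hq).exists_left_inv
    obtain ⟨c', hc'⟩ := (hI.isUnit_of_residue_eq_one hq').exists_right_inv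
    exact isUnit_iff_exists_and_exists.2
      ⟨⟨c * c', by rw [← mul_assoc, hc']⟩, ⟨b' * b, by rw [mul_assoc, hb']⟩⟩
  · refine (isUnit_of_map_unit (residue I) (1 + a) ?_).exists_left_inv
    rw [map_add, map_one, (residue_eq_zero_iff I).2 ha, add_zero]
    exact isUnit_one

theorem IsJacobson.isUnit_one_add (hI : IsJacobson I) {a : A} (ha : a ∈ I) : IsUnit (1 + a) :=
  hI.isUnit_of_residue_eq_one <| by
    rw [map_add, map_one, (residue_eq_zero_iff I).2 ha, add_zero]

theorem IsJacobson.isUnit_residue_iff (hI : IsJacobson I) {a : A} :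
    IsUnit (residue I a) ↔ IsUnit a :=
  have := isJacobson_iff_isLocalHom.1 hI
  isUnit_map_iff (residue I) a

theorem IsLocalPair.isJacobson (hI : IsLocalPair I) : IsJacobson I := by
  have mem_iff (a : A) : a ∈ I ↔ ¬IsUnit a := Set.ext_iff.1 hI a
  refine isJacobson_iff_isLocalHom.2 ⟨fun a ha => ?_⟩
  by_contra hunit
  rw [(residue_eq_zero_iff I).2 ((mem_iff a).2 hunit), isUnit_zero_iff, ← map_zero (residue I),
    ← map_one (residue I), residue_eq_residue_iff, zero_sub, neg_mem_iff, mem_iff] at ha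
  exact ha isUnit_one

theorem IsJacobson.isLocalPair_iff (hI : IsJacobson I) :
    IsLocalPair I ↔ ∀ q : I.ringCon.Quotient, IsUnit q ↔ q ≠ 0 := by
  rw [(residue_surjective I).forall, IsLocalPair, Set.ext_iff]
  refine forall_congr' fun a => ?_
  rw [hI.isUnit_residue_iff, Ne, residue_eq_zero_iff, SetLike.mem_coe, mem_nonunits_iff]
  tauto

theorem IsJacobson.natDegree_reduction (hI : IsJacobson I) {P : A[X]} (hP : P.Monic) :
    (reduction I P).natDegree = P.natDegree := by
  rcases subsingleton_or_nontrivial I.ringCon.Quotient with hsub | hnt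
  · have : Subsingleton A := isUnit_zero_iff.1 (hI.isUnit_residue_iff.1 (isUnit_of_subsingleton _))
      |> subsingleton_of_zero_eq_one
    rw [natDegree_of_subsingleton, natDegree_of_subsingleton]
  · exact hP.natDegree_map _

end Jacobson

section Perfect

variable {A B : Type*} [Ring A] [Ring B] {I : TwoSidedIdeal A} {J : TwoSidedIdeal B}
  {φ : A →+* B}

theorem commFiltration_le_comap (h : I ≤ J.comap φ) (n : ℕ) :
    commFiltration I n ≤ (commFiltration J n).comap φ := by
  induction n with
  | zero => exact h
  | succ n ih =>
    refine TwoSidedIdeal.span_le.2 ?_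
    rintro _ ⟨s, t, ht, rfl⟩
    rw [SetLike.mem_coe, TwoSidedIdeal.mem_comap, map_sub, map_mul, map_mul]
    exact TwoSidedIdeal.subset_span ⟨φ s, φ t, (TwoSidedIdeal.mem_comap φ).1 (ih ht), rfl⟩

theorem isPerfect_bot : IsPerfect (⊥ : TwoSidedIdeal A) :=
  le_bot_iff.1 (iInf_le (commFiltration (⊥ : TwoSidedIdeal A)) 0)

theorem IsPerfect.map_eq_zero (hJ : IsPerfect J) (h : I ≤ J.comap φ) {a : A}
    (ha : a ∈ ⨅ n, commFiltration I n) : φ a = 0 := by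
  rw [← TwoSidedIdeal.mem_bot, ← hJ, TwoSidedIdeal.mem_iInf]
  exact fun n => (TwoSidedIdeal.mem_comap φ).1
    (commFiltration_le_comap h n ((TwoSidedIdeal.mem_iInf _).1 ha n))

theorem IsPerfect.of_injective (hJ : IsPerfect J) (h : I ≤ J.comap φ)
    (hφ : Function.Injective φ) : IsPerfect I :=
  le_bot_iff.1 fun _ ha => (TwoSidedIdeal.mem_bot A).2 <|
    (map_eq_zero_iff φ hφ).1 (hJ.map_eq_zero h ha)

end Perfect

section Henselian

/-- The side on which coprimality is tested, so that left and right Henselian pairs are treated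
together. -/
inductive Side
  | left
  | right

variable {A B : Type*} [Ring A] [Ring B] {I : TwoSidedIdeal A} {J : TwoSidedIdeal B}
  {φ : A →+* B} {s : Side}

/-- Left or right coprimality of two polynomials. -/
def Side.Coprime : Side → A[X] → A[X] → Prop
  | .left => LeftCoprime
  | .right => RightCoprime

theorem Side.Coprime.map {f₁ f₂ : A[X]} (h : s.Coprime f₁ f₂) (φ : A →+* B) :
    s.Coprime (f₁.map φ) (f₂.map φ) := by
  cases s
  all_goals
    obtain ⟨g₁, g₂, hg⟩ := h
    refine ⟨g₁.map φ, g₂.map φ, ?_⟩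
    simp only [← Polynomial.map_mul, ← Polynomial.map_add, hg, Polynomial.map_one]

/-- Two monic polynomials which are coprime on the given side: the factors of the factorizations
which a Henselian pair lifts. -/
structure Side.IsCoprimeMonic (s : Side) (f₁ f₂ : A[X]) : Prop where
  monic_left : f₁.Monic
  monic_right : f₂.Monic
  coprime : s.Coprime f₁ f₂

theorem Side.IsCoprimeMonic.map {f₁ f₂ : A[X]} (h : s.IsCoprimeMonic f₁ f₂) (φ : A →+* B) :
    s.IsCoprimeMonic (f₁.map φ) (f₂.map φ) :=
  ⟨h.monic_left.map φ, h.monic_right.map φ, h.coprime.map φ⟩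

theorem Side.isCoprimeMonic_map_iff {f₁ f₂ : A[X]} (hφ : Function.Bijective φ) :
    s.IsCoprimeMonic (f₁.map φ) (f₂.map φ) ↔ s.IsCoprimeMonic f₁ f₂ := by
  refine ⟨fun h => ?_, fun h => h.map φ⟩
  let σ := RingEquiv.ofBijective φ hφ
  have hσ (f : A[X]) : (f.map φ).map (σ.symm : B →+* A) = f := by
    rw [Polynomial.map_map, show (σ.symm : B →+* A).comp φ = RingHom.id A from
      RingHom.ext σ.symm_apply_apply, Polynomial.map_id]
  simpa only [hσ] using h.map (σ.symm : B →+* A)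

/-- `P` is a factorization of `F` into monic polynomials which lifts the pair `f₁`, `f₂`. -/
def IsFactorization (I : TwoSidedIdeal A) (F : A[X]) (f₁ f₂ : I.ringCon.Quotient[X])
    (P : A[X] × A[X]) : Prop :=
  P.1.Monic ∧ P.2.Monic ∧ F = P.1 * P.2 ∧ reduction I P.1 = f₁ ∧ reduction I P.2 = f₂

theorem IsFactorization.map {F : A[X]} {f₁ f₂ : I.ringCon.Quotient[X]} {P : A[X] × A[X]}
    (hP : IsFactorization I F f₁ f₂ P) (h : I ≤ J.comap φ) :
    IsFactorization J (F.map φ) (f₁.map (residueMap h)) (f₂.map (residueMap h))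
      (P.1.map φ, P.2.map φ) := by
  obtain ⟨hP₁, hP₂, rfl, rfl, rfl⟩ := hP
  exact ⟨hP₁.map φ, hP₂.map φ, Polynomial.map_mul φ, reduction_map h _, reduction_map h _⟩

/-- Left or right Henselian pairs. -/
def IsHenselian (s : Side) (I : TwoSidedIdeal A) : Prop :=
  IsJacobson I ∧
    ∀ F : A[X], F.Monic → ∀ f₁ f₂ : I.ringCon.Quotient[X], f₁.Monic → f₂.Monic →
      s.Coprime f₁ f₂ → reduction I F = f₁ * f₂ → ∃! P, IsFactorization I F f₁ f₂ P

theorem isHenselian_left_iff : IsHenselian .left I ↔ IsLeftHenselian I := Iff.rfl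

theorem isHenselian_right_iff : IsHenselian .right I ↔ IsRightHenselian I := Iff.rfl

theorem IsHenselian.existsUnique_factorization (hI : IsHenselian s I) {F : A[X]} (hF : F.Monic)
    {f₁ f₂ : I.ringCon.Quotient[X]} (hf : s.IsCoprimeMonic f₁ f₂)
    (hmul : reduction I F = f₁ * f₂) : ∃! P, IsFactorization I F f₁ f₂ P :=
  hI.2 F hF f₁ f₂ hf.monic_left hf.monic_right hf.coprime hmul

theorem IsHenselian.factorization_unique (hI : IsHenselian s I) {F : A[X]}
    {f₁ f₂ : I.ringCon.Quotient[X]} (hf : s.IsCoprimeMonic f₁ f₂) {P Q : A[X] × A[X]}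
    (hP : IsFactorization I F f₁ f₂ P) (hQ : IsFactorization I F f₁ f₂ Q) : P = Q := by
  refine (hI.existsUnique_factorization ?_ hf ?_).unique hP hQ
  all_goals obtain ⟨hP₁, hP₂, rfl, rfl, rfl⟩ := hP
  · exact hP₁.mul hP₂
  · exact Polynomial.map_mul _

theorem isHenselian_bot (s : Side) : IsHenselian s (⊥ : TwoSidedIdeal A) := by
  have hbij : Function.Bijective (residue (⊥ : TwoSidedIdeal A)) := residue_bot_bijective
  have hinj := Polynomial.map_injective _ hbij.1
  refine ⟨fun a ha => ?_, fun F _ f₁ f₂ hf₁ hf₂ _ hF => ?_⟩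
  · rw [(TwoSidedIdeal.mem_bot A).1 ha]
    exact zero_mem _
  · obtain ⟨F₁, rfl⟩ := Polynomial.map_surjective _ hbij.2 f₁
    obtain ⟨F₂, rfl⟩ := Polynomial.map_surjective _ hbij.2 f₂
    refine ⟨(F₁, F₂), ⟨monic_of_injective hbij.1 hf₁, monic_of_injective hbij.1 hf₂,
      hinj (hF.trans (Polynomial.map_mul _).symm), rfl, rfl⟩, ?_⟩
    rintro ⟨G₁, G₂⟩ ⟨-, -, -, hG₁, hG₂⟩
    exact Prod.ext (hinj hG₁) (hinj hG₂)

end Henselian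

section Product

variable {ι : Type*} {R : ι → Type*} [∀ i, Ring (R i)] {J : ∀ i, TwoSidedIdeal (R i)}

theorem polynomial_ext_of_jointly_injective {A : Type*} [Ring A] {φ : ∀ i, A →+* R i}
    (hφ : ∀ a b, (∀ i, φ i a = φ i b) → a = b) {P Q : A[X]}
    (h : ∀ i, P.map (φ i) = Q.map (φ i)) : P = Q := by
  ext k
  refine hφ _ _ fun i => ?_
  rw [← coeff_map, h, coeff_map]

theorem exists_monic_map_evalRingHom_eq (P : ∀ i, (R i)[X]) (n : ℕ)
    (hdeg : ∀ i, (P i).natDegree ≤ n) (hcoeff : ∀ i, (P i).coeff n = 1) :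
    ∃ Q : (∀ i, R i)[X], Q.Monic ∧ ∀ i, Q.map (Pi.evalRingHom R i) = P i := by
  let Q : (∀ i, R i)[X] := ∑ k ∈ Finset.range (n + 1), monomial k fun i => (P i).coeff k
  have coeff_Q (k : ℕ) (hk : k ≤ n) : Q.coeff k = fun i => (P i).coeff k := by
    simp only [Q, finsetSum_coeff, coeff_monomial, Finset.sum_ite_eq', Finset.mem_range,
      Order.lt_add_one_iff, if_pos hk]
  have natDegree_Q : Q.natDegree ≤ n := natDegree_sum_le_of_forall_le _ _ fun k hk =>
    (natDegree_monomial_le _).trans (Finset.mem_range_succ_iff.1 hk)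
  refine ⟨Q, monic_of_natDegree_le_of_coeff_eq_one n natDegree_Q ?_, fun i => ?_⟩
  · rw [coeff_Q n le_rfl]
    exact funext hcoeff
  · refine (ext_iff_natDegree_le (natDegree_map_le.trans natDegree_Q) (hdeg i)).2 fun k hk => ?_
    rw [coeff_map, coeff_Q k hk, Pi.evalRingHom_apply]

/-- The ideal `∏ J i` of the product ring `∏ R i`. -/
def piIdeal (J : ∀ i, TwoSidedIdeal (R i)) : TwoSidedIdeal (∀ i, R i) :=
  ⨅ i, (J i).comap (Pi.evalRingHom R i)

theorem piIdeal_le_comap (J : ∀ i, TwoSidedIdeal (R i)) (i : ι) :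
    piIdeal J ≤ (J i).comap (Pi.evalRingHom R i) :=
  iInf_le _ i

theorem mem_piIdeal {a : ∀ i, R i} : a ∈ piIdeal J ↔ ∀ i, a i ∈ J i := by
  simp only [piIdeal, TwoSidedIdeal.mem_iInf, TwoSidedIdeal.mem_comap, Pi.evalRingHom_apply]

theorem residueMap_piIdeal_jointly_injective (q q' : (piIdeal J).ringCon.Quotient)
    (h : ∀ i, residueMap (piIdeal_le_comap J i) q = residueMap (piIdeal_le_comap J i) q') :
    q = q' := by
  obtain ⟨a, rfl⟩ := residue_surjective _ q
  obtain ⟨b, rfl⟩ := residue_surjective _ q'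
  simp only [residueMap_residue, residue_eq_residue_iff, Pi.evalRingHom_apply] at h
  exact (residue_eq_residue_iff _).2 (mem_piIdeal.2 h)

theorem IsPerfect.pi (hJ : ∀ i, IsPerfect (J i)) : IsPerfect (piIdeal J) :=
  le_bot_iff.1 fun _ ha => (TwoSidedIdeal.mem_bot _).2 <|
    funext fun i => (hJ i).map_eq_zero (piIdeal_le_comap J i) ha

theorem IsJacobson.pi (hJ : ∀ i, IsJacobson (J i)) : IsJacobson (piIdeal J) :=
  isJacobson_iff_isLocalHom.2 ⟨fun _ ha => Pi.isUnit_iff.2 fun i =>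
    (hJ i).isUnit_residue_iff.1 (ha.map (residueMap (piIdeal_le_comap J i)))⟩

theorem IsJacobson.natDegree_le_and_coeff_eq_one {A B : Type*} [Ring A] [Ring B]
    {J : TwoSidedIdeal B} (hJ : IsJacobson J) {ρ : A →+* J.ringCon.Quotient} {f : A[X]}
    (hf : f.Monic) {P : B[X]} (hP : P.Monic) (h : reduction J P = f.map ρ) :
    P.natDegree ≤ f.natDegree ∧ P.coeff f.natDegree = 1 := by
  have hle : P.natDegree ≤ f.natDegree := by
    rw [← hJ.natDegree_reduction hP, h]
    exact natDegree_map_le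
  refine ⟨hle, ?_⟩
  rcases subsingleton_or_nontrivial B with hsub | hnt
  · exact Subsingleton.elim _ _
  · have : Nontrivial J.ringCon.Quotient := by
      refine ⟨1, 0, fun h10 => not_isUnit_zero (M₀ := B) (hJ.isUnit_residue_iff.1 ?_)⟩
      rw [map_zero, ← h10]
      exact isUnit_one
    rw [← hf.natDegree_map ρ, ← h, hJ.natDegree_reduction hP]
    exact hP

theorem exists_monic_lift_pi (hJ : ∀ i, IsJacobson (J i)) {f : (piIdeal J).ringCon.Quotient[X]}
    (hf : f.Monic) {P : ∀ i, (R i)[X]} (hP : ∀ i, (P i).Monic)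
    (hred : ∀ i, reduction (J i) (P i) = f.map (residueMap (piIdeal_le_comap J i))) :
    ∃ Q : (∀ i, R i)[X], Q.Monic ∧ (∀ i, Q.map (Pi.evalRingHom R i) = P i) ∧
      reduction (piIdeal J) Q = f := by
  have hdeg i := (hJ i).natDegree_le_and_coeff_eq_one hf (hP i) (hred i)
  obtain ⟨Q, hQ, hQP⟩ := exists_monic_map_evalRingHom_eq P f.natDegree
    (fun i => (hdeg i).1) fun i => (hdeg i).2
  refine ⟨Q, hQ, hQP,
    polynomial_ext_of_jointly_injective residueMap_piIdeal_jointly_injective fun i => ?_⟩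
  rw [← reduction_map, hQP, hred]

theorem IsHenselian.pi {s : Side} (hJ : ∀ i, IsHenselian s (J i)) :
    IsHenselian s (piIdeal J) := by
  let ρ (i : ι) := residueMap (piIdeal_le_comap J i)
  refine ⟨IsJacobson.pi fun i => (hJ i).1, fun F hF f₁ f₂ hf₁ hf₂ hf hmul => ?_⟩
  have hlift (i : ι) : ∃! P, IsFactorization (J i) (F.map (Pi.evalRingHom R i))
      (f₁.map (ρ i)) (f₂.map (ρ i)) P := by
    refine (hJ i).existsUnique_factorization (hF.map _)
      (Side.IsCoprimeMonic.map ⟨hf₁, hf₂, hf⟩ _) ?_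
    rw [reduction_map (piIdeal_le_comap J i), hmul, Polynomial.map_mul]
  choose P hP hPuniq using hlift
  obtain ⟨F₁, hF₁, hFP₁, hr₁⟩ :=
    exists_monic_lift_pi (fun i => (hJ i).1) hf₁ (fun i => (hP i).1)
    fun i => (hP i).2.2.2.1
  obtain ⟨F₂, hF₂, hFP₂, hr₂⟩ :=
    exists_monic_lift_pi (fun i => (hJ i).1) hf₂ (fun i => (hP i).2.1)
    fun i => (hP i).2.2.2.2
  have ext {G G' : (∀ i, R i)[X]}
      (h : ∀ i, G.map (Pi.evalRingHom R i) = G'.map (Pi.evalRingHom R i)) : G = G' :=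
    polynomial_ext_of_jointly_injective (fun _ _ => _root_.funext) h
  refine ⟨(F₁, F₂), ⟨hF₁, hF₂, ext fun i => ?_, hr₁, hr₂⟩, fun G hG => ?_⟩
  · rw [Polynomial.map_mul, hFP₁, hFP₂]
    exact (hP i).2.2.1
  · have hGP i := hPuniq i _ (hG.map (piIdeal_le_comap J i))
    refine Prod.ext (ext fun i => ?_) (ext fun i => ?_)
    · rw [hFP₁, ← hGP]
    · rw [hFP₂, ← hGP]

end Product

section Closure

variable {A B H : Type*} [Ring A] [Ring B] [Ring H] {I : TwoSidedIdeal A} {J : TwoSidedIdeal B}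
  {K : TwoSidedIdeal H} {φ : A →+* B} {η : A →+* H} {ι : H →+* B} {s : Side}

/-- The subrings of `B` which contain the image of `A` and are stable under the two operations
available in a Henselian pair `(B, J)` under `(A, I)`: inverting `1 + b` with `b ∈ J`, and lifting
factorizations. Only factorizations with residues coming from `A[x]` are used, which suffices
because the residue ring does not grow (`residue_comp_surjective_of_eq_top`). -/
structure IsHenselClosed (s : Side) (I : TwoSidedIdeal A) (J : TwoSidedIdeal B) (φ : A →+* B)
    (S : Subring B) : Prop where
  map_mem (a : A) : φ a ∈ S
  inverse_mem {b c : B} : b ∈ S → b ∈ J → c * (1 + b) = 1 → c ∈ S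
  factor_mem {g₁ g₂ : A[X]} {F : B[X]} {P : B[X] × B[X]} :
    s.IsCoprimeMonic (reduction I g₁) (reduction I g₂) →
      IsFactorization J F (reduction J (g₁.map φ)) (reduction J (g₂.map φ)) P →
        (∀ k, F.coeff k ∈ S) → (∀ k, P.1.coeff k ∈ S) ∧ ∀ k, P.2.coeff k ∈ S

/-- The subring of `B` generated by `A` under the operations of `IsHenselClosed`. -/
def henselClosure (s : Side) (I : TwoSidedIdeal A) (J : TwoSidedIdeal B) (φ : A →+* B) :
    Subring B :=
  sInf {S | IsHenselClosed s I J φ S}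

theorem henselClosure_le {S : Subring B} (hS : IsHenselClosed s I J φ S) :
    henselClosure s I J φ ≤ S :=
  sInf_le hS

theorem isHenselClosed_henselClosure (s : Side) (I : TwoSidedIdeal A) (J : TwoSidedIdeal B)
    (φ : A →+* B) : IsHenselClosed s I J φ (henselClosure s I J φ) where
  map_mem a := Subring.mem_sInf.2 fun _ hS => hS.map_mem a
  inverse_mem hb hbJ hc := Subring.mem_sInf.2 fun _ hS =>
    hS.inverse_mem (henselClosure_le hS hb) hbJ hc
  factor_mem hg hP hF :=
    have mem {S} (hS : IsHenselClosed s I J φ S) :=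
      hS.factor_mem hg hP fun k => henselClosure_le hS (hF k)
    ⟨fun k => Subring.mem_sInf.2 fun _ hS => (mem hS).1 k,
      fun k => Subring.mem_sInf.2 fun _ hS => (mem hS).2 k⟩

theorem exists_map_eq_of_coeff_mem_range {P : B[X]} (h : ∀ k, P.coeff k ∈ ι.range) :
    ∃ Q : H[X], Q.map ι = P :=
  (mem_lifts P).1 ((lifts_iff_coeff_lifts P).2 h)

theorem isFactorization_map_iff (hι : Function.Injective ι) (hK : IsHom K J ι) {F P₁ P₂ : H[X]}
    {f₁ f₂ : K.ringCon.Quotient[X]} :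
    IsFactorization J (F.map ι) (f₁.map (residueMap hK.le_comap)) (f₂.map (residueMap hK.le_comap))
      (P₁.map ι, P₂.map ι) ↔ IsFactorization K F f₁ f₂ (P₁, P₂) := by
  refine ⟨?_, fun h => h.map hK.le_comap⟩
  rintro ⟨hP₁, hP₂, hF, hr₁, hr₂⟩
  have residue_inj := Polynomial.map_injective _ hK.residueMap_injective
  refine ⟨monic_of_injective hι hP₁, monic_of_injective hι hP₂, Polynomial.map_injective ι hι ?_,
    residue_inj ?_, residue_inj ?_⟩
  · rw [hF, Polynomial.map_mul]
  · rw [← reduction_map, hr₁]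
  · rw [← reduction_map, hr₂]

theorem IsFactorization.exists_of_map (hι : Function.Injective ι) (hK : IsHom K J ι) {F : H[X]}
    {f₁ f₂ : K.ringCon.Quotient[X]} {P : B[X] × B[X]}
    (hP : IsFactorization J (F.map ι) (f₁.map (residueMap hK.le_comap))
      (f₂.map (residueMap hK.le_comap)) P)
    (hP₁ : ∀ k, P.1.coeff k ∈ ι.range) (hP₂ : ∀ k, P.2.coeff k ∈ ι.range) :
    ∃ Q, IsFactorization K F f₁ f₂ Q ∧ P = (Q.1.map ι, Q.2.map ι) := by
  obtain ⟨Q₁, hQ₁⟩ := exists_map_eq_of_coeff_mem_range hP₁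
  obtain ⟨Q₂, hQ₂⟩ := exists_map_eq_of_coeff_mem_range hP₂
  obtain rfl : P = (Q₁.map ι, Q₂.map ι) := Prod.ext hQ₁.symm hQ₂.symm
  exact ⟨(Q₁, Q₂), (isFactorization_map_iff hι hK).1 hP, rfl⟩

theorem IsHenselClosed.map {S : Subring H} (hι : Function.Injective ι) (hK : IsHom K J ι)
    (hrange : IsHenselClosed s I J (ι.comp η) ι.range) (hS : IsHenselClosed s I K η S) :
    IsHenselClosed s I J (ι.comp η) (S.map ι) where
  map_mem a := ⟨η a, hS.map_mem a, rfl⟩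
  inverse_mem := by
    rintro _ c ⟨b, hb, rfl⟩ hbJ hc
    obtain ⟨c, rfl⟩ := hrange.inverse_mem ⟨b, rfl⟩ hbJ hc
    refine ⟨c, hS.inverse_mem hb ((hK b).1 hbJ) (hι ?_), rfl⟩
    rw [map_mul, map_add, map_one, hc]
  factor_mem {g₁ g₂ F P} hg hP hF := by
    obtain ⟨hP₁, hP₂⟩ := hrange.factor_mem hg hP fun k => (hF k).imp fun _ => And.right
    obtain ⟨F, rfl⟩ := exists_map_eq_of_coeff_mem_range fun k => (hF k).imp fun _ => And.right
    rw [← reduction_map_map hK.le_comap, ← reduction_map_map hK.le_comap] at hP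
    obtain ⟨Q, hQ, rfl⟩ := hP.exists_of_map hι hK hP₁ hP₂
    have hF' (k : ℕ) : F.coeff k ∈ S := by
      obtain ⟨c, hc, hcF⟩ := hF k
      rw [coeff_map] at hcF
      exact hι hcF ▸ hc
    obtain ⟨hQ₁, hQ₂⟩ := hS.factor_mem hg hQ hF'
    exact ⟨fun k => ⟨_, hQ₁ k, (coeff_map ι k).symm⟩, fun k => ⟨_, hQ₂ k, (coeff_map ι k).symm⟩⟩

theorem henselClosure_eq_top_of_range_eq (hι : Function.Injective ι) (hK : IsHom K J ι)
    (hrange : ι.range = henselClosure s I J (ι.comp η)) : henselClosure s I K η = ⊤ := by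
  have hclosed : IsHenselClosed s I J (ι.comp η) ι.range :=
    hrange ▸ isHenselClosed_henselClosure s I J (ι.comp η)
  have hle : ι.range ≤ (henselClosure s I K η).map ι := hrange.le.trans <|
    henselClosure_le (hclosed.map hι hK (isHenselClosed_henselClosure s I K η))
  refine (Subring.eq_top_iff' _).2 fun h => ?_
  obtain ⟨h', hh', heq⟩ := hle ⟨h, rfl⟩
  exact hι heq ▸ hh'

theorem residue_comp_surjective_of_eq_top (hgen : henselClosure s I K η = ⊤) :
    Function.Surjective ((residue K).comp η) := by
  have hcoeff {P : H[X]} {g : A[X]} (h : reduction K P = reduction K (g.map η)) (k : ℕ) :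
      residue K (P.coeff k) = residue K (η (g.coeff k)) := by
    simpa only [coeff_map] using congr_arg (coeff · k) h
  have hclosed : IsHenselClosed s I K η (((residue K).comp η).range.comap (residue K)) :=
    { map_mem := fun a => ⟨a, rfl⟩
      inverse_mem := fun {b c} _ hb hc => by
        have hc1 : residue K c = 1 := by
          rw [← map_one (residue K), ← hc, mul_one_add, map_add, map_mul _ c b,
            (residue_eq_zero_iff K).2 hb, mul_zero, add_zero]
        rw [Subring.mem_comap, hc1]
        exact one_mem _
      factor_mem := fun {g₁ g₂ F P} _ hP _ =>
        ⟨fun k => ⟨g₁.coeff k, (hcoeff hP.2.2.2.1 k).symm⟩,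
          fun k => ⟨g₂.coeff k, (hcoeff hP.2.2.2.2 k).symm⟩⟩ }
  intro q
  obtain ⟨h, rfl⟩ := residue_surjective K q
  exact henselClosure_le hclosed (hgen ▸ Subring.mem_top h)

theorem IsHenselian.of_isHenselClosed_range (hJ : IsHenselian s J) (hι : Function.Injective ι)
    (hK : IsHom K J ι) (hη : IsHom I K η) (hsurj : Function.Surjective ((residue K).comp η))
    (hrange : IsHenselClosed s I J (ι.comp η) ι.range) : IsHenselian s K := by
  constructor
  · refine isJacobson_iff_exists_mul_one_add.2 fun b hb => ?_
    obtain ⟨c, hc⟩ := isJacobson_iff_exists_mul_one_add.1 hJ.1 (ι b) ((hK b).2 hb)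
    obtain ⟨c, rfl⟩ := hrange.inverse_mem ⟨b, rfl⟩ ((hK b).2 hb) hc
    exact ⟨c, hι <| by rw [map_mul, map_add, map_one, hc]⟩
  intro F hF f₁ f₂ hf₁ hf₂ hf hmul
  have hfm : s.IsCoprimeMonic f₁ f₂ := ⟨hf₁, hf₂, hf⟩
  obtain ⟨P, hP, hPuniq⟩ := hJ.existsUnique_factorization (hF.map ι)
    (hfm.map (residueMap hK.le_comap))
    (by rw [reduction_map hK.le_comap, hmul, Polynomial.map_mul])
  have hlift (f : K.ringCon.Quotient[X]) : ∃ g : A[X], reduction K (g.map η) = f :=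
    (Polynomial.map_surjective _ hsurj f).imp fun g hg => (Polynomial.map_map _ _ g).trans hg
  obtain ⟨g₁, rfl⟩ := hlift f₁
  obtain ⟨g₂, rfl⟩ := hlift f₂
  have hg : s.IsCoprimeMonic (reduction I g₁) (reduction I g₂) := by
    have hbij : Function.Bijective (residueMap hη.le_comap) :=
      ⟨hη.residueMap_injective, fun q => (hsurj q).imp' (residue I) fun _ h => h⟩
    rwa [← Side.isCoprimeMonic_map_iff hbij, ← reduction_map, ← reduction_map]
  have hrange_mem := hrange.factor_mem (F := F.map ι) (P := P) hg ?_ ?_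
  · obtain ⟨Q, hQ, rfl⟩ := hP.exists_of_map hι hK hrange_mem.1 hrange_mem.2
    refine ⟨Q, hQ, fun Q' hQ' => ?_⟩
    have heq := hPuniq _ (hQ'.map hK.le_comap)
    exact Prod.ext (Polynomial.map_injective ι hι (congr_arg Prod.fst heq))
      (Polynomial.map_injective ι hι (congr_arg Prod.snd heq))
  · rwa [← reduction_map_map hK.le_comap, ← reduction_map_map hK.le_comap]
  · exact fun k => ⟨F.coeff k, (coeff_map ι k).symm⟩

theorem hom_ext_of_henselClosure_eq_top {ψ₁ ψ₂ : H →+* B} (hgen : henselClosure s I K η = ⊤)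
    (hJ : IsHenselian s J) (hη : I ≤ K.comap η) (hψ₁ : K ≤ J.comap ψ₁) (hψ₂ : K ≤ J.comap ψ₂)
    (hcomp : ψ₁.comp η = ψ₂.comp η) : ψ₁ = ψ₂ := by
  suffices hclosed : IsHenselClosed s I K η (ψ₁.eqLocus ψ₂) from
    RingHom.ext fun h => henselClosure_le hclosed (hgen ▸ Subring.mem_top h)
  refine ⟨RingHom.congr_fun hcomp, fun {b c} (hb : ψ₁ b = ψ₂ b) hbK hc => ?_,
    fun {g₁ g₂ F P} hg hP hF => ?_⟩
  · have hunit : IsUnit (1 + ψ₂ b) :=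
      hJ.1.isUnit_one_add ((TwoSidedIdeal.mem_comap ψ₂).1 (hψ₂ hbK))
    refine hunit.mul_right_cancel ?_
    have hmap (ψ : H →+* B) : ψ c * (1 + ψ b) = 1 := by
      rw [← map_one ψ, ← map_add, ← map_mul, hc]
    rw [hmap ψ₂, ← hb, hmap ψ₁]
  · have hmap₁ := hP.map hψ₁
    have hmap₂ := hP.map hψ₂
    have hηψ₂ : I ≤ J.comap (ψ₂.comp η) :=
      (hη.trans (TwoSidedIdeal.comap_le_comap η hψ₂)).trans_eq (J.comap_comap η ψ₂)
    have hg' := hg.map (residueMap hηψ₂)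
    rw [← reduction_map, ← reduction_map] at hg'
    rw [reduction_map_map, reduction_map_map] at hmap₁ hmap₂
    have hFmap : F.map ψ₁ = F.map ψ₂ := by
      ext k
      rw [coeff_map, coeff_map, hF k]
    rw [hcomp, hFmap] at hmap₁
    have heq := hJ.factorization_unique hg' hmap₁ hmap₂
    have hcoeff {Q : H[X]} (hQ : Q.map ψ₁ = Q.map ψ₂) (k : ℕ) :
        ψ₁ (Q.coeff k) = ψ₂ (Q.coeff k) := by
      rw [← coeff_map, hQ, coeff_map]
    exact ⟨hcoeff (congr_arg Prod.fst heq), hcoeff (congr_arg Prod.snd heq)⟩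

end Closure

section Small

universe v w

theorem exists_small_subset_closed {α : Type u} {κ : α → Type w} {B : Type v} [Nonempty B]
    (values : ∀ i, (κ i → B) → Set B) (hvalues : ∀ i x, (values i x).Subsingleton) :
    ∃ S : Set B, Small.{max u w} S ∧ ∀ i x, (∀ k, x k ∈ S) → values i x ⊆ S := by
  let eval : WType κ → B := WType.elim B fun p => Classical.epsilon (· ∈ values p.1 p.2)
  refine ⟨Set.range eval, small_range eval, fun i x hx y hy => ?_⟩
  choose t ht using hx
  obtain rfl : (fun k => eval (t k)) = x := funext ht
  exact ⟨WType.mk i t, hvalues i _ (Classical.epsilon_spec (p := (· ∈ values i _)) ⟨y, hy⟩) hy⟩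

/-- Names for the operations under which the subrings of `IsHenselClosed` are stable. `base a` is
the constant `a`, and `fst g₁ g₂ k`, `snd g₁ g₂ k` send the coefficients of a polynomial to the
coefficient of `x ^ k` of the first and second factor lifting the residues of `g₁`, `g₂`. -/
inductive HenselOp (A : Type u) [Ring A] : Type u
  | base (a : A)
  | add
  | mul
  | neg
  | inverse
  | fst (g₁ g₂ : A[X]) (k : ℕ)
  | snd (g₁ g₂ : A[X]) (k : ℕ)

/-- The index type of the arguments of an operation. -/
def HenselOp.arity {A : Type u} [Ring A] : HenselOp A → Type
  | base _ => Fin 0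
  | add | mul => Fin 2
  | neg | inverse => Fin 1
  | fst _ _ _ | snd _ _ _ => ℕ

/-- The set of values of an operation at given arguments. It has at most one element if `(B, J)` is
Henselian; it may be empty, as the partial operations `inverse`, `fst` and `snd` need not apply. -/
def HenselOp.values {A : Type u} {B : Type v} [Ring A] [Ring B] (s : Side) (I : TwoSidedIdeal A)
    (J : TwoSidedIdeal B) (φ : A →+* B) : ∀ o : HenselOp A, (o.arity → B) → Set B
  | base a, _ => {φ a}
  | add, (x : Fin 2 → B) => {x 0 + x 1}
  | mul, (x : Fin 2 → B) => {x 0 * x 1}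
  | neg, (x : Fin 1 → B) => {-x 0}
  | inverse, (x : Fin 1 → B) => {c | x 0 ∈ J ∧ c * (1 + x 0) = 1}
  | fst g₁ g₂ k, x => {y | s.IsCoprimeMonic (reduction I g₁) (reduction I g₂) ∧ ∃ F P,
      IsFactorization J F (reduction J (g₁.map φ)) (reduction J (g₂.map φ)) P ∧
        F.coeff = x ∧ P.1.coeff k = y}
  | snd g₁ g₂ k, x => {y | s.IsCoprimeMonic (reduction I g₁) (reduction I g₂) ∧ ∃ F P,
      IsFactorization J F (reduction J (g₁.map φ)) (reduction J (g₂.map φ)) P ∧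
        F.coeff = x ∧ P.2.coeff k = y}

variable {A : Type u} {B : Type v} [Ring A] [Ring B] {I : TwoSidedIdeal A} {J : TwoSidedIdeal B}
  {φ : A →+* B} {s : Side}

theorem HenselOp.values_subsingleton (hJ : IsHenselian s J) (hφ : I ≤ J.comap φ) (o : HenselOp A)
    (x : o.arity → B) : (o.values s I J φ x).Subsingleton := by
  have unique {g₁ g₂ : A[X]} (hg : s.IsCoprimeMonic (reduction I g₁) (reduction I g₂))
      {F F' : B[X]} {P P' : B[X] × B[X]}
      (hP : IsFactorization J F (reduction J (g₁.map φ)) (reduction J (g₂.map φ)) P)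
      (hP' : IsFactorization J F' (reduction J (g₁.map φ)) (reduction J (g₂.map φ)) P')
      (hF : F.coeff = F'.coeff) : P = P' := by
    obtain rfl := coeff_injective hF
    refine hJ.factorization_unique ?_ hP hP'
    rw [reduction_map hφ, reduction_map hφ]
    exact hg.map _
  cases o with
  | base | add | mul | neg => exact Set.subsingleton_singleton
  | inverse =>
    exact fun c hc c' hc' =>
      (hJ.1.isUnit_one_add hc.1).mul_right_cancel (hc.2.trans hc'.2.symm)
  | fst g₁ g₂ k | snd g₁ g₂ k =>
    rintro _ ⟨hg, F, P, hP, hF, rfl⟩ _ ⟨-, F', P', hP', hF', rfl⟩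
    rw [unique hg hP hP' (hF.trans hF'.symm)]

theorem exists_isHenselClosed_of_values_subset {S : Set B}
    (hS : ∀ (o : HenselOp A) (x : o.arity → B), (∀ k, x k ∈ S) → o.values s I J φ x ⊆ S) :
    ∃ T : Subring B, (T : Set B) = S ∧ IsHenselClosed s I J φ T := by
  have hbase (a : A) : φ a ∈ S := hS (.base a) Fin.elim0 Fin.rec0 rfl
  let T : Subring B :=
    { carrier := S
      zero_mem' := map_zero φ ▸ hbase 0
      one_mem' := map_one φ ▸ hbase 1
      add_mem' := fun {a b} ha hb => hS .add ![a, b] (Fin.forall_fin_two.2 ⟨ha, hb⟩) rfl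
      mul_mem' := fun {a b} ha hb => hS .mul ![a, b] (Fin.forall_fin_two.2 ⟨ha, hb⟩) rfl
      neg_mem' := fun {a} ha => hS .neg ![a] (Fin.forall_fin_one.2 ha) rfl }
  refine ⟨T, rfl, hbase, fun {b c} hb hbJ hc => ?_,
    fun {g₁ g₂ F P} hg hP hF => ⟨fun k => ?_, fun k => ?_⟩⟩
  · exact hS .inverse ![b] (Fin.forall_fin_one.2 hb) ⟨hbJ, hc⟩
  · exact hS (.fst g₁ g₂ k) F.coeff hF ⟨hg, F, P, hP, rfl, rfl⟩
  · exact hS (.snd g₁ g₂ k) F.coeff hF ⟨hg, F, P, hP, rfl, rfl⟩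

theorem small_henselClosure (hJ : IsHenselian s J) (hφ : I ≤ J.comap φ) :
    Small.{u} (henselClosure s I J φ) := by
  obtain ⟨S, hsmall, hS⟩ :=
    exists_small_subset_closed (HenselOp.values s I J φ) (HenselOp.values_subsingleton hJ hφ)
  obtain ⟨T, rfl, hT⟩ := exists_isHenselClosed_of_values_subset hS
  exact small_subset (henselClosure_le hT)

theorem exists_small_henselian_subpair (hJ : IsHenselian s J) (hφ : IsHom I J φ) :
    ∃ (H : Type u) (_ : Ring H) (K : TwoSidedIdeal H) (η : A →+* H) (ι : H →+* B),
      Function.Injective ι ∧ ι.comp η = φ ∧ IsHom I K η ∧ IsHom K J ι ∧ IsHenselian s K ∧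
        henselClosure s I K η = ⊤ := by
  have := small_henselClosure hJ hφ.le_comap
  have hclosed := isHenselClosed_henselClosure s I J φ
  obtain ⟨H, _, ⟨e⟩⟩ : ∃ (H : Type u) (_ : Ring H), Nonempty (henselClosure s I J φ ≃+* H) :=
    ⟨_, _, ⟨(Shrink.ringEquiv _).symm⟩⟩
  let ι : H →+* B := (henselClosure s I J φ).subtype.comp e.symm
  let η : A →+* H := RingHom.comp e (φ.codRestrict _ hclosed.map_mem)
  have hι : Function.Injective ι := Subtype.val_injective.comp e.symm.injective
  have hrange : ι.range = henselClosure s I J φ := by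
    refine le_antisymm ?_ fun b hb => ⟨e ⟨b, hb⟩, congr_arg Subtype.val (e.symm_apply_apply _)⟩
    rintro _ ⟨h, rfl⟩
    exact (e.symm h).2
  have hcomp : ι.comp η = φ := RingHom.ext fun a =>
    congr_arg Subtype.val (e.symm_apply_apply (φ.codRestrict _ hclosed.map_mem a))
  clear_value ι η
  subst hcomp
  have hK : IsHom (J.comap ι) J ι := isHom_comap J ι
  have hη : IsHom I (J.comap ι) η := fun a => (hK (η a)).symm.trans (hφ a)
  have hgen := henselClosure_eq_top_of_range_eq hι hK hrange
  exact ⟨H, _, J.comap ι, η, ι, hι, rfl, hη, hK,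
    hJ.of_isHenselClosed_range hι hK hη (residue_comp_surjective_of_eq_top hgen)
      (hrange ▸ hclosed), hgen⟩

end Small

section Henselization

/-- The perfect Henselian pairs under `(A, I)` in the universe of `A`: the factors of the product in
which the Henselization is found. -/
structure PerfectHenselianExtension (s : Side) {A : Type u} [Ring A] (I : TwoSidedIdeal A) :
    Type (u + 1) where
  carrier : Type u
  [ring : Ring carrier]
  ideal : TwoSidedIdeal carrier
  hom : A →+* carrier
  isHom : IsHom I ideal hom
  isPerfect : IsPerfect ideal
  isHenselian : IsHenselian s ideal

attribute [instance] PerfectHenselianExtension.ring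

/-- `η : (A, I) → (H, K)` is a left or right Henselization. -/
structure IsHenselization (s : Side) {A H : Type u} [Ring A] [Ring H] (I : TwoSidedIdeal A)
    (K : TwoSidedIdeal H) (η : A →+* H) : Prop where
  isHom : IsHom I K η
  isPerfect : IsPerfect K
  isHenselian : IsHenselian s K
  universal : ∀ (B : Type u) [Ring B] (J : TwoSidedIdeal B), IsPerfect J → IsHenselian s J →
    ∀ φ : A →+* B, IsHom I J φ → ∃! ψ : H →+* B, IsHom K J ψ ∧ ψ.comp η = φ

variable {A H : Type u} [Ring A] [Ring H] {I : TwoSidedIdeal A} {K : TwoSidedIdeal H}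
  {η : A →+* H} {s : Side}

theorem isHenselization_left_iff : IsHenselization .left I K η ↔ IsLeftHenselization I K η :=
  ⟨fun h => ⟨h.1, h.2, isHenselian_left_iff.1 h.3,
      by simpa only [isHenselian_left_iff] using h.4⟩,
    fun h => ⟨h.1, h.2, isHenselian_left_iff.2 h.3,
      by simpa only [isHenselian_left_iff] using h.4⟩⟩

theorem isHenselization_right_iff : IsHenselization .right I K η ↔ IsRightHenselization I K η :=
  ⟨fun h => ⟨h.1, h.2, isHenselian_right_iff.1 h.3,
      by simpa only [isHenselian_right_iff] using h.4⟩,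
    fun h => ⟨h.1, h.2, isHenselian_right_iff.2 h.3,
      by simpa only [isHenselian_right_iff] using h.4⟩⟩

theorem isHom_pi_hom (s : Side) (I : TwoSidedIdeal A) :
    IsHom I (piIdeal fun E : PerfectHenselianExtension s I => E.ideal)
      (RingHom.pi fun E => E.hom) := fun a => by
  let residueExtension : PerfectHenselianExtension s I :=
    ⟨I.ringCon.Quotient, ⊥, residue I, isHom_residue I, isPerfect_bot, isHenselian_bot s⟩
  rw [mem_piIdeal]
  exact ⟨fun ha => (residueExtension.isHom a).1 (ha _), fun ha E => (E.isHom a).2 ha⟩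

theorem exists_isHenselization (s : Side) (I : TwoSidedIdeal A) :
    ∃ (H : Type u) (_ : Ring H) (K : TwoSidedIdeal H) (η : A →+* H), IsHenselization s I K η := by
  let Ext := PerfectHenselianExtension s I
  obtain ⟨H, _, K, η, ι, hι, hcomp, hη, hK, hH, hgen⟩ := exists_small_henselian_subpair
    (IsHenselian.pi fun E : Ext => E.isHenselian) (isHom_pi_hom s I)
  have hperf : IsPerfect K :=
    (IsPerfect.pi fun E : Ext => E.isPerfect).of_injective hK.le_comap hι
  refine ⟨H, _, K, η, hη, hperf, hH, fun B _ J hJ hB φ hφ => ?_⟩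
  let E : Ext := ⟨B, J, φ, hφ, hJ, hB⟩
  let ψ : H →+* B := (Pi.evalRingHom _ E).comp ι
  have hψK : K ≤ J.comap ψ :=
    (hK.le_comap.trans (TwoSidedIdeal.comap_le_comap ι (piIdeal_le_comap _ E))).trans_eq
      (J.comap_comap ι _)
  have hψη : ψ.comp η = φ := by
    rw [RingHom.comp_assoc, hcomp]
    rfl
  have hψ : IsHom K J ψ :=
    isHom_of_isHom_comp hη.le_comap (residue_comp_surjective_of_eq_top hgen) hψK (hψη.symm ▸ hφ)
  exact ⟨ψ, ⟨hψ, hψη⟩, fun ψ' hψ' => hom_ext_of_henselClosure_eq_top hgen hB hη.le_comap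
    hψ'.1.le_comap hψK (hψ'.2.trans hψη.symm)⟩

theorem IsHenselization.residue_comp_surjective (h : IsHenselization s I K η) :
    Function.Surjective ((residue K).comp η) := by
  obtain ⟨H', _, K', η', ι, hι, hcomp, hη', hK', hH', hgen⟩ :=
    exists_small_henselian_subpair h.isHenselian h.isHom
  obtain ⟨ψ, ⟨hψ, hψη⟩, -⟩ :=
    h.universal H' K' (h.isPerfect.of_injective hK'.le_comap hι) hH' η' hη'
  have hιψ : ι.comp ψ = RingHom.id H :=
    (h.universal H K h.isPerfect h.isHenselian η h.isHom).unique
      ⟨hK'.comp hψ, by rw [RingHom.comp_assoc, hψη, hcomp]⟩ ⟨fun _ => Iff.rfl, RingHom.id_comp η⟩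
  intro q
  obtain ⟨x, rfl⟩ := residue_surjective K q
  obtain ⟨a, ha⟩ := residue_comp_surjective_of_eq_top hgen (residue K' (ψ x))
  have hx : ι (ψ x) = x := RingHom.congr_fun hιψ x
  refine ⟨a, ?_⟩
  calc residue K (η a)
      = residueMap hK'.le_comap (residue K' (η' a)) := by rw [← hcomp]; rfl
    _ = residueMap hK'.le_comap (residue K' (ψ x)) := congr_arg _ ha
    _ = residue K x := by rw [residueMap_residue, hx]

theorem IsHenselization.isLocalPair_iff (h : IsHenselization s I K η) :
    IsLocalPair K ↔ ∀ q : I.ringCon.Quotient, IsUnit q ↔ q ≠ 0 := by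
  have hsurj : Function.Surjective (residueMap h.isHom.le_comap) := fun q =>
    (h.residue_comp_surjective q).imp' (residue I) fun _ ha => ha
  let e := RingEquiv.ofBijective _ ⟨h.isHom.residueMap_injective, hsurj⟩
  rw [h.isHenselian.1.isLocalPair_iff, e.surjective.forall]
  refine forall_congr' fun q => ?_
  rw [MulEquiv.isUnit_map, map_ne_zero_iff e e.injective]

end Henselization

end RingPair

theorem mainTheorem6_general {A : Type u} [Ring A] (I : TwoSidedIdeal A) :
    ((∃ (H : Type u) (_ : Ring H) (K : TwoSidedIdeal H) (η : A →+* H),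
        RingPair.IsLeftHenselization I K η) ∧
      ∀ (H : Type u) [Ring H] (K : TwoSidedIdeal H) (η : A →+* H),
        RingPair.IsLeftHenselization I K η →
          (RingPair.IsLocalPair K ↔ ∀ q : I.ringCon.Quotient, IsUnit q ↔ q ≠ 0)) ∧
    ((∃ (H : Type u) (_ : Ring H) (K : TwoSidedIdeal H) (η : A →+* H),
        RingPair.IsRightHenselization I K η) ∧
      ∀ (H : Type u) [Ring H] (K : TwoSidedIdeal H) (η : A →+* H),
        RingPair.IsRightHenselization I K η →
          (RingPair.IsLocalPair K ↔ ∀ q : I.ringCon.Quotient, IsUnit q ↔ q ≠ 0)) := by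
  simp only [← RingPair.isHenselization_left_iff, ← RingPair.isHenselization_right_iff]
  exact ⟨⟨RingPair.exists_isHenselization .left I, fun _ _ _ _ h => h.isLocalPair_iff⟩,
    ⟨RingPair.exists_isHenselization .right I, fun _ _ _ _ h => h.isLocalPair_iff⟩⟩

theorem mainTheorem6 {A : Type u} [Ring A] (I : TwoSidedIdeal A)
    (hperf : RingPair.IsPerfect I) (hloc : RingPair.IsLocalPair I) :
    ((∃ (H : Type u) (_ : Ring H) (K : TwoSidedIdeal H) (η : A →+* H),
        RingPair.IsLeftHenselization I K η) ∧
      ∀ (H : Type u) [Ring H] (K : TwoSidedIdeal H) (η : A →+* H),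
        RingPair.IsLeftHenselization I K η → RingPair.IsLocalPair K) ∧
    ((∃ (H : Type u) (_ : Ring H) (K : TwoSidedIdeal H) (η : A →+* H),
        RingPair.IsRightHenselization I K η) ∧
      ∀ (H : Type u) [Ring H] (K : TwoSidedIdeal H) (η : A →+* H),
        RingPair.IsRightHenselization I K η → RingPair.IsLocalPair K) := by
  have hres := hloc.isJacobson.isLocalPair_iff.1 hloc
  exact (mainTheorem6_general I).imp
    (And.imp_right fun hlocal H _ K η h => (hlocal H K η h).2 hres)
    (And.imp_right fun hlocal H _ K η h => (hlocal H K η h).2 hres)
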